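/- **Setting.** Fix finite sets $\mathcal{L}$ of locations and $\mathcal{C}$ of clocks. A valuation is an element $\nu\in\mathbb{R}_{\ge 0}^{\mathcal{C}}$; for $d\ge 0$ the valuation $\nu+d$ is given by $(\nu+d)(x)=\nu(x)+d$, and for $R\subseteq\mathcal{C}$ the valuation $\nu[R:=0]$ vanishes on $R$ and agrees with $\nu$ elsewhere. A guard $g$ is a finite conjunction of constraints $k\preceq x\preceq' l$ or $k\preceq x-y\preceq' l$ with $x,y\in\mathcal{C}$, $k,l\in\mathbb{Z}\cup\{\pm\infty\}$ and $\preceq,\preceq'\in\{<,\le\}$. It is *non-punctual* if there are two distinct valuations $\nu$ and $\nu+d$, $d\ge 0$, that satisfy $g$, and *punctual* otherwise. A bounded timed automaton consists of an integer bound $M\geq 1$, an initial location in $\mathcal{L}$ and a set $E$ of edges $(\ell,g,R,\ell')$ with $\ell,\ell'\in\mathcal{L}$, $g$ a guard and $R\subseteq\mathcal{C}$. A *region* is given by integral parts $\iota:\mathcal{C}\to\{0,\dots,M-1\}$ and an ordered partition $\beta_0\uplus\dots\uplus\beta_m$ of $\mathcal{C}$ in which only $\beta_0$ may be empty. It is the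 set of valuations $\nu$ such that $\lfloor\nu(x)\rfloor=\iota(x)$ for all $x$, the fractional part of $\nu(x)$ is $0$ exactly for $x\in\beta_0$, fractional parts are equal within each block, and they strictly increase with the index of the block. A region is *non-punctual* if it contains two distinct valuations of the form $\nu$ and $\nu+d$ with $d\ge 0$, and *punctual* otherwise. A region $r'$ is a time-successor of $r$ if for every $\nu\in r$ there is $d\ge 0$ with $\nu+d\in r'$; $r[R:=0]$ is the region that contains $\nu[R:=0]$ for all $\nu\in r$; and $r\models g$ means that every $\nu\in r$ satisfies $g$. A finite *region path* is a finite sequence of consecutive transitions between pairs (location, region), each of which is either a delay transition $(\ell,r)\xrightarrow{\mathsf{delay}}(\ell,r')$ with $r'$ a time-successor of $r$, or an edge transition $(\ell,r)\xrightarrow{g,R}(\ell',r[R:=0])$ with $(\ell,g,R,\ell')\in E$ and $r\models g$. It is *well-formed* if it starts with a delay transition, alternates between delay and edge transitions, and ends with an edge transition. A well-formed finite region path is *robust* if every edge transition $(\ell,r)\xrightarrow{g,R}(\ell',r')$ in it whose guard $g$ is non-punctual has a non-punctual region $r$. For an atomic well-formed path $\pi=(\ell,r)\xrightarrow{\mathsf{delay}}(\ell,r')\xrightarrow{g,R}(\ell',r'')$,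 a set $s$ of valuations and $\delta\ge 0$, let $$\mathsf{CPre}_\pi^\delta(s)=\{\nu\in r\mid\exists d\ge\delta,\ \forall d'\in[d-\delta,d+\delta],\ \nu+d'\in r'\wedge(\nu+d')[R:=0]\in s\}$$ if $g$ is non-punctual, and $$\mathsf{CPre}_\pi^\delta(s)=\{\nu\in r\mid\exists d\ge 0,\ \nu+d\in r'\wedge(\nu+d)[R:=0]\in s\}$$ if $g$ is punctual; for a concatenation of well-formed paths, $\mathsf{CPre}_{\pi'\pi''}^\delta(s)=\mathsf{CPre}_{\pi'}^\delta(\mathsf{CPre}_{\pi''}^\delta(s))$. **Proposition.** Let $\pi$ be a well-formed finite region path of a bounded timed automaton from $(\ell,r)$ to $(\ell',r')$. Then there exists $\delta>0$ such that $\mathsf{CPre}_\pi^\delta(r')\neq\emptyset$ if and only if $\pi$ is robust. -/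

import Mathlib

open scoped NNReal

namespace TA

/-- Clock valuations: elements of `ℝ≥0 ^ C`. -/
abbrev Valuation (C : Type*) := C → ℝ≥0

/-- The time-successor `ν + d`. -/
def Valuation.shift {C : Type*} (ν : Valuation C) (d : ℝ≥0) : Valuation C :=
  fun x => ν x + d

open Classical in
/-- The valuation `ν[R := 0]`. -/
noncomputable def Valuation.reset {C : Type*} (ν : Valuation C) (R : Set C) : Valuation C :=
  fun x => if x ∈ R then 0 else ν x

/-- Elements of `ℤ ∪ {-∞, ∞}`. -/
inductive ExtInt where
  | negInf : ExtInt
  | int : ℤ → ExtInt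
  | posInf : ExtInt

noncomputable def ExtInt.toEReal : ExtInt → EReal
  | .negInf => ⊥
  | .int k => ((k : ℝ) : EReal)
  | .posInf => ⊤

/-- The comparison symbols `<` and `≤`. -/
inductive Cmp where
  | lt : Cmp
  | le : Cmp

def Cmp.Holds : Cmp → EReal → EReal → Prop
  | .lt, a, b => a < b
  | .le, a, b => a ≤ b

/-- The terms `x` and `x - y` that a constraint bounds. -/
inductive ClockTerm (C : Type*) where
  | clock : C → ClockTerm C
  | diff : C → C → ClockTerm C

def ClockTerm.eval {C : Type*} (ν : Valuation C) : ClockTerm C → ℝ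
  | .clock x => (ν x : ℝ)
  | .diff x y => (ν x : ℝ) - (ν y : ℝ)

/-- Atomic clock constraints `k ⪯ x ⪯' l` and `k ⪯ x - y ⪯' l`. -/
structure AtomicConstraint (C : Type*) where
  lower : ExtInt
  lowerCmp : Cmp
  term : ClockTerm C
  upperCmp : Cmp
  upper : ExtInt

def AtomicConstraint.Sat {C : Type*} (ν : Valuation C) (a : AtomicConstraint C) : Prop :=
  a.lowerCmp.Holds a.lower.toEReal ((a.term.eval ν : ℝ) : EReal) ∧
    a.upperCmp.Holds ((a.term.eval ν : ℝ) : EReal) a.upper.toEReal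

/-- Guards: finite conjunctions of atomic clock constraints. -/
abbrev Guard (C : Type*) := List (AtomicConstraint C)

/-- `ν ⊨ g`. -/
def Guard.Sat {C : Type*} (g : Guard C) (ν : Valuation C) : Prop :=
  ∀ a ∈ g, a.Sat ν

/-- At least two (that is, two distinct) valuations `ν` and `ν + d` satisfy `g`.
A guard is punctual when it is not non-punctual. -/
def Guard.NonPunctual {C : Type*} (g : Guard C) : Prop :=
  ∃ (ν : Valuation C) (d : ℝ≥0), ν ≠ ν.shift d ∧ g.Sat ν ∧ g.Sat (ν.shift d)

/-- An edge `(ℓ, g, R, ℓ')`. -/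
structure Edge (L C : Type*) where
  source : L
  guard : Guard C
  resets : Set C
  target : L

/-- A bounded timed automaton with locations `L` and clocks `C`. -/
structure TimedAutomaton (L C : Type*) where
  bound : ℕ
  bound_pos : 0 < bound
  start : L
  edges : Set (Edge L C)

/-- A region with clock bound `M`, as a pair `(ι, β)`: integral parts below `M`, and an ordered
partition `β₀ ⊎ β₁ ⊎ ⋯ ⊎ β_dim` of the clocks, where `block x` is the index `i` with `x ∈ β_i`.
Only `β₀` may be empty. -/
structure Region (C : Type*) (M : ℕ) where
  intPart : C → ℕ
  intPart_lt : ∀ x, intPart x < M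
  dim : ℕ
  block : C → ℕ
  block_le : ∀ x, block x ≤ dim
  block_nonempty : ∀ i, 1 ≤ i → i ≤ dim → ∃ x, block x = i

/-- The set of valuations of a region: fractional parts vanish exactly on `β₀`, are constant on
each block, and strictly increase with the block index. -/
def Region.toSet {C : Type*} {M : ℕ} (r : Region C M) : Set (Valuation C) :=
  {ν | (∀ x, ⌊(ν x : ℝ)⌋ = (r.intPart x : ℤ)) ∧
    (∀ x, r.block x = 0 ↔ Int.fract (ν x : ℝ) = 0) ∧
    (∀ x y, r.block x = r.block y → Int.fract (ν x : ℝ) = Int.fract (ν y : ℝ)) ∧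
    (∀ x y, r.block x < r.block y → Int.fract (ν x : ℝ) < Int.fract (ν y : ℝ))}

/-- The region contains at least two distinct valuations, one a time-successor of the other. -/
def Region.NonPunctual {C : Type*} {M : ℕ} (r : Region C M) : Prop :=
  ∃ (ν : Valuation C) (d : ℝ≥0), ν ≠ ν.shift d ∧ ν ∈ r.toSet ∧ ν.shift d ∈ r.toSet

/-- `r'` is a time-successor of `r`. -/
def Region.TimeSucc {C : Type*} {M : ℕ} (r r' : Region C M) : Prop :=
  ∀ ν ∈ r.toSet, ∃ d : ℝ≥0, ν.shift d ∈ r'.toSet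

/-- `r' = r[R := 0]`. -/
def Region.IsReset {C : Type*} {M : ℕ} (r : Region C M) (R : Set C) (r' : Region C M) : Prop :=
  ∀ ν ∈ r.toSet, ν.reset R ∈ r'.toSet

/-- `r ⊨ g`. -/
def Region.Models {C : Type*} {M : ℕ} (r : Region C M) (g : Guard C) : Prop :=
  ∀ ν ∈ r.toSet, g.Sat ν

/-- Region states `(ℓ, r)`. -/
abbrev RegionState (L C : Type*) (M : ℕ) := L × Region C M

/-- Labelled transitions between region states: `delay ℓ r r'` is `(ℓ,r) → (ℓ,r')`, and
`edge e r r'` is `(e.source, r) → (e.target, r')` along the edge `e`. -/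
inductive Transition (L C : Type*) (M : ℕ) where
  | delay : L → Region C M → Region C M → Transition L C M
  | edge : Edge L C → Region C M → Region C M → Transition L C M

def Transition.source {L C : Type*} {M : ℕ} : Transition L C M → RegionState L C M
  | .delay l r _ => (l, r)
  | .edge e r _ => (e.source, r)

def Transition.target {L C : Type*} {M : ℕ} : Transition L C M → RegionState L C M
  | .delay l _ r' => (l, r')
  | .edge e _ r' => (e.target, r')

/-- The transitions that the timed automaton allows. -/
def Transition.Valid {L C : Type*} (A : TimedAutomaton L C) : Transition L C A.bound → Prop
  | .delay _ r r' => r.TimeSucc r'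
  | .edge e r r' => e ∈ A.edges ∧ r.Models e.guard ∧ r.IsReset e.resets r'

/-- `π` is a finite region path of `A` from `p` to `q`. -/
def IsRegionPath {L C : Type*} (A : TimedAutomaton L C) :
    RegionState L C A.bound → List (Transition L C A.bound) → RegionState L C A.bound → Prop
  | p, [], q => p = q
  | p, t :: π, q => t.source = p ∧ t.Valid A ∧ IsRegionPath A t.target π q

/-- `π` starts with a delay, alternates between delays and edges, and ends with an edge. -/
def WellFormed {L C : Type*} {M : ℕ} : List (Transition L C M) → Prop
  | .delay _ _ _ :: .edge _ _ _ :: π => π = [] ∨ WellFormed π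
  | _ => False

/-- Every edge transition with a non-punctual guard is taken from a non-punctual region. -/
def Robust {L C : Type*} {M : ℕ} (π : List (Transition L C M)) : Prop :=
  ∀ (e : Edge L C) (r r' : Region C M),
    Transition.edge e r r' ∈ π → e.guard.NonPunctual → r.NonPunctual

open Classical in
/-- Controllable predecessors along `(ℓ,r) —delay→ (ℓ,r') —g,R→ (ℓ',r'')`.
The subtraction `d - δ` is never truncated, as `δ ≤ d`. -/
noncomputable def atomicCPre {C : Type*} {M : ℕ} (δ : ℝ≥0) (r r' : Region C M) (g : Guard C)
    (R : Set C) (s : Set (Valuation C)) : Set (Valuation C) :=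
  if g.NonPunctual then
    {ν | ν ∈ r.toSet ∧ ∃ d : ℝ≥0, δ ≤ d ∧ ∀ d' ∈ Set.Icc (d - δ) (d + δ),
      ν.shift d' ∈ r'.toSet ∧ (ν.shift d').reset R ∈ s}
  else
    {ν | ν ∈ r.toSet ∧ ∃ d : ℝ≥0, ν.shift d ∈ r'.toSet ∧ (ν.shift d).reset R ∈ s}

/-- Controllable predecessors of `s` along a well-formed region path, by composition over its
atomic sub-paths. The last case only concerns lists that are not well-formed. -/
noncomputable def CPre {L C : Type*} {M : ℕ} (δ : ℝ≥0) :
    List (Transition L C M) → Set (Valuation C) → Set (Valuation C)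
  | [], s => s
  | .delay _ r r' :: .edge e _ _ :: π, s => atomicCPre δ r r' e.guard e.resets (CPre δ π s)
  | _, _ => ∅

end TA

/-! Add to a valuation a reference clock with constant value 0. Its region then records exactly how
the integer translates of all clocks are ordered (`Region.mem_toSet_iff`). A back-and-forth argument
on such orders shows that every point of the target of a delay or reset has a preimage in the source
region.

If the path is robust, induct backwards with the stronger invariant `HasCore`: for all small δ at
once, the controllable predecessors contain a relative neighbourhood of a point of the region. In
`HasCore.atomicCPre`, either no clock is integral in the region where the edge is taken, and small
changes of delay and valuation are harmless; or some clock is integral, so the guard is punctual by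
robustness, and the delay that makes this clock integral depends continuously on the valuation.

Conversely, a delay window of positive width inside a region contains two distinct valuations, so
that region is non-punctual. -/

namespace TA

/-! ### Back-and-forth for orders of integer translates -/

/-- `a` and `b` restricted to `S` order the translates by integers of their values alike. -/
def SimOn {K : Type*} (S : Set K) (a b : K → ℝ) : Prop :=
  ∀ x ∈ S, ∀ y ∈ S, ∀ k : ℤ, a x ≤ a y + k ↔ b x ≤ b y + k

/-- If `t` is a translate of some `a x`, the same translate of `b x` serves. Otherwise `t` lies
strictly between neighbouring translates of each `a x`, and finitely many strict bounds on `t'` have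
to be met. -/
theorem SimOn.exists_point {K : Type*} [Finite K] {S : Set K} {a b : K → ℝ} (h : SimOn S a b)
    (t : ℝ) : ∃ t' : ℝ, ∀ x ∈ S, ∀ k : ℤ,
      (a x ≤ t + k ↔ b x ≤ t' + k) ∧ (t ≤ a x + k ↔ t' ≤ b x + k) := by
  by_cases ht : ∃ x ∈ S, ∃ k : ℤ, t = a x + k
  · obtain ⟨x₀, hx₀, k₀, rfl⟩ := ht
    refine ⟨b x₀ + k₀, fun x hx k => ⟨?_, ?_⟩⟩
    · have := h x hx x₀ hx₀ (k₀ + k)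
      push_cast at this
      simpa only [add_assoc] using this
    · have := h x₀ hx₀ x hx (k - k₀)
      push_cast at this
      constructor <;> intro h'
      · linarith [this.1 (by linarith)]
      · linarith [this.2 (by linarith)]
  · push Not at ht
    have hlow : ∀ x ∈ S, a x + ⌊t - a x⌋ < t := fun x hx =>
      lt_of_le_of_ne (by linarith [Int.floor_le (t - a x)]) (ht x hx _).symm
    have hupp : ∀ x, t < a x + ⌊t - a x⌋ + 1 := fun x => by
      linarith [Int.lt_floor_add_one (t - a x)]
    -- Every lower bound lies below every upper bound, since a reversed pair would transfer back to
    -- `a` and contradict the position of `t`.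
    have hsep : ∀ x ∈ S, ∀ y ∈ S, b x + ⌊t - a x⌋ < b y + ⌊t - a y⌋ + 1 := by
      intro x hx y hy
      by_contra! hle
      have := (h y hy x hx (⌊t - a x⌋ - ⌊t - a y⌋ - 1)).2 (by push_cast; linarith)
      push_cast at this
      linarith [hlow x hx, hupp y]
    obtain ⟨t', ht'⟩ := Order.exists_between_finsets
      (lo := (S.toFinite.image fun x => b x + ⌊t - a x⌋).toFinset)
      (hi := (S.toFinite.image fun x => b x + ⌊t - a x⌋ + 1).toFinset) (by
        simp only [Set.Finite.mem_toFinset, Set.mem_image]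
        rintro _ ⟨x, hx, rfl⟩ _ ⟨y, hy, rfl⟩
        exact hsep x hx y hy)
    simp only [Set.Finite.mem_toFinset, Set.mem_image] at ht'
    refine ⟨t', fun x hx k => ?_⟩
    have h1 := hlow x hx
    have h2 := hupp x
    have h3 := ht'.1 _ ⟨x, hx, rfl⟩
    have h4 := ht'.2 _ ⟨x, hx, rfl⟩
    constructor
    · rcases le_or_gt (-k) ⌊t - a x⌋ with hk | hk
      · have hk' : -(k : ℝ) ≤ ⌊t - a x⌋ := by exact_mod_cast hk
        exact iff_of_true (by linarith) (by linarith)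
      · have hk' : (⌊t - a x⌋ : ℝ) + 1 ≤ -k := by exact_mod_cast hk
        exact iff_of_false (by linarith) (by linarith)
    · rcases le_or_gt k ⌊t - a x⌋ with hk | hk
      · have hk' : (k : ℝ) ≤ ⌊t - a x⌋ := by exact_mod_cast hk
        exact iff_of_false (by linarith) (by linarith)
      · have hk' : (⌊t - a x⌋ : ℝ) + 1 ≤ k := by exact_mod_cast hk
        exact iff_of_true (by linarith) (by linarith)

open Classical in
theorem SimOn.exists_insert {K : Type*} [Finite K] {S : Set K} {a b : K → ℝ} (h : SimOn S a b)
    (z : K) : ∃ b', Set.EqOn b' b S ∧ SimOn (insert z S) a b' := by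
  by_cases hz : z ∈ S
  · exact ⟨b, fun _ _ => rfl, by rwa [Set.insert_eq_of_mem hz]⟩
  obtain ⟨t', ht'⟩ := h.exists_point (a z)
  have hne : ∀ x ∈ S, x ≠ z := fun x hx hxz => hz (hxz ▸ hx)
  refine ⟨Function.update b z t', fun x hx => Function.update_of_ne (hne x hx) _ _, ?_⟩
  rintro x (rfl | hx) y (rfl | hy) k
  · simp
  · simpa [hne y hy] using (ht' y hy k).2
  · simpa [hne x hx] using (ht' x hx k).1
  · simpa [hne x hx, hne y hy] using h x hx y hy k

theorem SimOn.exists_extension {K : Type*} [Finite K] {S : Set K} {a b : K → ℝ}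
    (h : SimOn S a b) : ∃ b', Set.EqOn b' b S ∧ SimOn Set.univ a b' := by
  suffices ∀ T : Set K, ∃ b', Set.EqOn b' b S ∧ SimOn (T ∪ S) a b' by
    simpa using this Set.univ
  intro T
  induction T, T.toFinite using Set.Finite.induction_on with
  | empty => exact ⟨b, fun _ _ => rfl, by simpa using h⟩
  | insert _ _ ih =>
    obtain ⟨b₁, h₁, h₂⟩ := ih
    rename_i z T _ _
    obtain ⟨b₂, h₃, h₄⟩ := h₂.exists_insert z
    exact ⟨b₂, fun x hx => (h₃ (Or.inr hx)).trans (h₁ hx), by rwa [Set.insert_union]⟩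

/-! ### Regions as order types -/

variable {C : Type*} {M : ℕ}

/-- A valuation together with a reference clock `none` that is always `0`. -/
def Valuation.ext (ν : Valuation C) : Option C → ℝ
  | none => 0
  | some x => ν x

@[simp] theorem Valuation.ext_none (ν : Valuation C) : ν.ext none = 0 := rfl
@[simp] theorem Valuation.ext_some (ν : Valuation C) (x : C) : ν.ext (some x) = ν x := rfl

/-- Integral parts of a region, with reference clock. -/
def Region.extInt (r : Region C M) : Option C → ℤ
  | none => 0
  | some x => r.intPart x

/-- Blocks of a region, with reference clock. -/
def Region.extBlock (r : Region C M) : Option C → ℕ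
  | none => 0
  | some x => r.block x

theorem Region.mem_toSet_iff (r : Region C M) (ν : Valuation C) :
    ν ∈ r.toSet ↔ ∀ x y (k : ℤ), ν.ext x ≤ ν.ext y + k ↔
      r.extInt x < r.extInt y + k ∨ (r.extInt x = r.extInt y + k ∧ r.extBlock x ≤ r.extBlock y) := by
  constructor
  · rintro ⟨h1, h2, h3, h4⟩ x y k
    have hfl : ∀ x, ⌊ν.ext x⌋ = r.extInt x := by
      rintro (_ | x)
      · simp [Region.extInt]
      · exact h1 x
    have hlt : ∀ x y, r.extBlock x < r.extBlock y → Int.fract (ν.ext x) < Int.fract (ν.ext y) := by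
      rintro (_ | x) (_ | y) hxy
      · simp at hxy
      · have : Int.fract (ν y : ℝ) ≠ 0 := fun h => by
          have := (h2 y).2 h
          simp [Region.extBlock, this] at hxy
        simpa using lt_of_le_of_ne (Int.fract_nonneg _) this.symm
      · simp [Region.extBlock] at hxy
      · exact h4 x y hxy
    have heq : ∀ x y, r.extBlock x = r.extBlock y → Int.fract (ν.ext x) = Int.fract (ν.ext y) := by
      rintro (_ | x) (_ | y) hxy
      · rfl
      · simpa using ((h2 y).1 hxy.symm).symm
      · simpa using (h2 x).1 hxy
      · exact h3 x y hxy
    have hle : Int.fract (ν.ext x) ≤ Int.fract (ν.ext y) ↔ r.extBlock x ≤ r.extBlock y := by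
      constructor
      · intro h
        by_contra! hc
        exact absurd (hlt _ _ hc) (not_lt.2 h)
      · intro h
        rcases h.lt_or_eq with h | h
        · exact (hlt _ _ h).le
        · exact (heq _ _ h).le
    have ex := Int.floor_add_fract (ν.ext x)
    have ey := Int.floor_add_fract (ν.ext y)
    rw [hfl] at ex ey
    have x0 := Int.fract_nonneg (ν.ext x)
    have x1 := Int.fract_lt_one (ν.ext x)
    have y0 := Int.fract_nonneg (ν.ext y)
    have y1 := Int.fract_lt_one (ν.ext y)
    rw [← hle]
    rcases lt_trichotomy (r.extInt x) (r.extInt y + k) with h | h | h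
    · have h' : (r.extInt x : ℝ) + 1 ≤ r.extInt y + k := by exact_mod_cast h
      exact iff_of_true (by linarith) (Or.inl h)
    · have h' : (r.extInt x : ℝ) = r.extInt y + k := by exact_mod_cast h
      constructor
      · exact fun _ => Or.inr ⟨h, by linarith⟩
      · rintro (h'' | ⟨_, h''⟩)
        · omega
        · linarith
    · have h' : (r.extInt y : ℝ) + k + 1 ≤ r.extInt x := by exact_mod_cast h
      refine iff_of_false (by linarith) ?_
      rintro (h'' | ⟨h'', _⟩) <;> omega
  · intro h
    have hfl : ∀ x, ⌊(ν x : ℝ)⌋ = (r.intPart x : ℤ) := by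
      intro x
      rw [Int.floor_eq_iff]
      constructor
      · have := (h none (some x) (-(r.intPart x : ℤ))).2
          (Or.inr ⟨by simp [Region.extInt], Nat.zero_le _⟩)
        simp at this
        exact_mod_cast this
      · by_contra! hc
        have := (h none (some x) (-(r.intPart x : ℤ) - 1)).1 (by
          push_cast at hc ⊢; simp; linarith)
        simp only [Region.extInt] at this
        omega
    have hfr : ∀ x, Int.fract (ν x : ℝ) = ν x - r.intPart x := by
      intro x
      rw [Int.fract, hfl]
      simp
    have hle : ∀ x y, Int.fract (ν x : ℝ) ≤ Int.fract (ν y : ℝ) ↔ r.block x ≤ r.block y := by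
      intro x y
      have := h (some x) (some y) (r.intPart x - r.intPart y)
      simp [Region.extInt, Region.extBlock] at this
      rw [← this, hfr, hfr]
      constructor <;> intro h' <;> linarith
    refine ⟨hfl, fun x => ?_, fun x y hxy => ?_, fun x y hxy => ?_⟩
    · have := h (some x) none (r.intPart x)
      simp [Region.extInt, Region.extBlock] at this
      rw [← this]
      have h0 := Int.fract_nonneg (ν x : ℝ)
      rw [hfr] at h0 ⊢
      constructor <;> intro h' <;> linarith
    · exact le_antisymm ((hle x y).2 hxy.le) ((hle y x).2 hxy.ge)
    · by_contra! hc
      exact absurd ((hle y x).1 hc) (not_le.2 hxy)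

theorem Region.simOn {r : Region C M} {ν μ : Valuation C} (hν : ν ∈ r.toSet) (hμ : μ ∈ r.toSet)
    (S : Set (Option C)) : SimOn S ν.ext μ.ext := fun x _ y _ k =>
  ((r.mem_toSet_iff ν).1 hν x y k).trans ((r.mem_toSet_iff μ).1 hμ x y k).symm

theorem Region.mem_of_simOn {r : Region C M} {ν μ : Valuation C} (hν : ν ∈ r.toSet)
    (h : SimOn Set.univ ν.ext μ.ext) : μ ∈ r.toSet :=
  (r.mem_toSet_iff μ).2 fun x y k =>
    (h x trivial y trivial k).symm.trans ((r.mem_toSet_iff ν).1 hν x y k)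

/-- Differences of clocks and values of clocks determine the region. -/
theorem simOn_univ_of {ν μ : Valuation C}
    (hd : ∀ x y (k : ℤ), (ν x : ℝ) ≤ ν y + k ↔ (μ x : ℝ) ≤ μ y + k)
    (hu : ∀ x (k : ℤ), (ν x : ℝ) ≤ k ↔ (μ x : ℝ) ≤ k)
    (hl : ∀ x (k : ℤ), (k : ℝ) ≤ ν x ↔ (k : ℝ) ≤ μ x) : SimOn Set.univ ν.ext μ.ext := by
  rintro (_ | x) - (_ | y) - k
  · simp
  · have := hl y (-k)
    push_cast at this
    simp only [Valuation.ext_none, Valuation.ext_some]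
    rw [← neg_le_iff_add_nonneg, ← neg_le_iff_add_nonneg]
    exact this
  · simpa using hu x k
  · exact hd x y k

@[simp] theorem Valuation.shift_coe (ν : Valuation C) (d : ℝ≥0) (x : C) :
    ((ν.shift d x : ℝ≥0) : ℝ) = ν x + d := by simp [Valuation.shift]

/-! ### Surjectivity of delays and resets between regions -/

theorem Region.toSet_nonempty (r : Region C M) : r.toSet.Nonempty := by
  have hpos : (0 : ℝ) < r.dim + 1 := by positivity
  have hfr : ∀ x, (r.block x : ℝ) / (r.dim + 1) < 1 := fun x => by
    rw [div_lt_one hpos]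
    exact_mod_cast Nat.lt_succ_of_le (r.block_le x)
  have hfr0 : ∀ x, (0 : ℝ) ≤ (r.block x : ℝ) / (r.dim + 1) := fun x => by positivity
  have hfract : ∀ x, Int.fract ((r.intPart x : ℝ) + (r.block x : ℝ) / (r.dim + 1)) =
      (r.block x : ℝ) / (r.dim + 1) := fun x => by
    rw [Int.fract_natCast_add, Int.fract_eq_self.2 ⟨hfr0 x, hfr x⟩]
  refine ⟨fun x => (r.intPart x : ℝ≥0) + (r.block x : ℝ≥0) / (r.dim + 1), ?_, ?_, ?_, ?_⟩
  · intro x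
    push_cast
    rw [Int.floor_natCast_add, Int.floor_eq_zero_iff.2 ⟨hfr0 x, hfr x⟩, add_zero]
  · intro x
    push_cast
    rw [hfract, div_eq_zero_iff]
    simp [hpos.ne']
  · intro x y hxy
    push_cast
    rw [hfract, hfract, hxy]
  · intro x y hxy
    push_cast
    rw [hfract, hfract]
    have : (r.block x : ℝ) < r.block y := by exact_mod_cast hxy
    gcongr

/-- Going back by the delay `d₀` compares clocks with translates of `d₀`, so a point `t` placed
among the clocks of `ν'` as `d₀` is among those of `ν₀.shift d₀` is the delay to undo. -/
theorem Region.TimeSucc.exists_pred [Finite C] {r r' : Region C M} (h : r.TimeSucc r')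
    {ν' : Valuation C} (hν' : ν' ∈ r'.toSet) :
    ∃ ν ∈ r.toSet, ∃ d : ℝ≥0, ν.shift d = ν' := by
  obtain ⟨ν₀, hν₀⟩ := r.toSet_nonempty
  obtain ⟨d₀, hd₀⟩ := h ν₀ hν₀
  have hsim := Region.simOn hd₀ hν' Set.univ
  obtain ⟨t, ht⟩ := hsim.exists_point d₀
  have ht0 : 0 ≤ t := by
    have := ((ht none trivial 0).1).1 (by simp)
    simpa using this
  lift t to ℝ≥0 using ht0
  have hle : ∀ x, t ≤ ν' x := fun x => by
    have := ((ht (some x) trivial 0).2).1 (by simp)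
    simpa using this
  have hcoe : ∀ x, ((ν' x - t : ℝ≥0) : ℝ) = ν' x - t := fun x => NNReal.coe_sub (hle x)
  refine ⟨fun x => ν' x - t, Region.mem_of_simOn hν₀ (simOn_univ_of ?_ ?_ ?_), t, ?_⟩
  · intro x y k
    have := hsim (some x) trivial (some y) trivial k
    simp only [Valuation.ext_some, Valuation.shift_coe] at this
    rw [hcoe, hcoe]
    constructor <;> intro h'
    · linarith [this.1 (by linarith)]
    · linarith [this.2 (by linarith)]
  · intro x k
    have := (ht (some x) trivial k).1
    simp only [Valuation.ext_some, Valuation.shift_coe] at this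
    rw [hcoe]
    constructor <;> intro h'
    · linarith [this.1 (by linarith)]
    · linarith [this.2 (by linarith)]
  · intro x k
    have := (ht (some x) trivial (-k)).2
    simp only [Valuation.ext_some, Valuation.shift_coe] at this
    push_cast at this
    rw [hcoe]
    constructor <;> intro h'
    · linarith [this.1 (by linarith)]
    · linarith [this.2 (by linarith)]
  · funext x
    exact tsub_add_cancel_of_le (hle x)

/-- The clocks outside `R` and the reference clock are already ordered as in `ν₀`; back-and-forth
supplies values for the clocks in `R`. -/
theorem Region.IsReset.exists_pred [Finite C] {r r' : Region C M} {R : Set C}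
    (h : r.IsReset R r') {ν' : Valuation C} (hν' : ν' ∈ r'.toSet) :
    ∃ ν ∈ r.toSet, ν.reset R = ν' := by
  obtain ⟨ν₀, hν₀⟩ := r.toSet_nonempty
  have hr := h ν₀ hν₀
  let S : Set (Option C) := {x | ∀ y ∈ R, x ≠ some y}
  have hS : ∀ x ∈ S, (ν₀.reset R).ext x = ν₀.ext x := by
    rintro (_ | x) hx
    · rfl
    · have : x ∉ R := fun hxR => hx x hxR rfl
      simp [Valuation.reset, this]
  have hsim : SimOn S ν₀.ext ν'.ext := fun x hx y hy k => by
    have := Region.simOn hr hν' S x hx y hy k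
    rwa [hS x hx, hS y hy] at this
  obtain ⟨b, hb, hb'⟩ := hsim.exists_extension
  have hb0 : b none = 0 := hb (by intro y _; simp)
  have hbn : ∀ x, 0 ≤ b (some x) := fun x => by
    have := (hb' none trivial (some x) trivial 0).1 (by simp)
    simpa [hb0] using this
  refine ⟨fun x => ⟨b (some x), hbn x⟩, Region.mem_of_simOn hν₀ ?_, ?_⟩
  · convert hb' using 1
    funext x
    rcases x with _ | x
    · exact hb0.symm
    · rfl
  · funext x
    by_cases hx : x ∈ R
    · have h0 : ν₀.reset R x = 0 := by simp [Valuation.reset, hx]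
      have := (Region.simOn hr hν' Set.univ (some x) trivial none trivial 0).1 (by simp [h0])
      have h1 : ν' x = 0 := NNReal.eq (le_antisymm (by simpa using this) (ν' x).coe_nonneg)
      simp only [Valuation.reset, hx, ↓reduceIte, h1]
    · simp only [Valuation.reset, hx, ↓reduceIte]
      exact NNReal.eq (hb (show some x ∈ S from fun y hy hxy => hx (by
        rw [Option.some.inj hxy]; exact hy)))

/-! ### Punctuality and perturbation of delays -/

theorem shift_ne_iff [Nonempty C] (ν : Valuation C) (d : ℝ≥0) : ν ≠ ν.shift d ↔ d ≠ 0 := by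
  refine not_congr ⟨fun h => ?_, fun h => ?_⟩
  · have := congrFun h (Classical.arbitrary C)
    simpa [Valuation.shift] using this
  · funext x
    simp [Valuation.shift, h]

theorem Region.NonPunctual.block_ne_zero {r : Region C M} (h : r.NonPunctual) (x : C) :
    r.block x ≠ 0 := by
  intro hx
  obtain ⟨ν, d, hne, h1, h2⟩ := h
  have : Nonempty C := ⟨x⟩
  refine (shift_ne_iff ν d).1 hne ?_
  have e1 := Int.floor_add_fract (ν x : ℝ)
  have e2 := Int.floor_add_fract (ν.shift d x : ℝ)
  rw [h1.1, (h1.2.1 x).1 hx] at e1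
  rw [h2.1, (h2.2.1 x).1 hx, Valuation.shift_coe] at e2
  exact NNReal.eq (by push_cast; linarith)

/-- In a region without integral clocks, delays can be perturbed around any valuation. -/
theorem Region.exists_margin [Finite C] {r r' : Region C M} (h0 : ∀ x, r'.block x ≠ 0)
    {ν : Valuation C} (hν : ν ∈ r.toSet) {d : ℝ≥0} (hd : ν.shift d ∈ r'.toSet) :
    ∃ ε : ℝ, 0 < ε ∧ ∀ ν₁ ∈ r.toSet, ∀ d₁ : ℝ≥0,
      (∀ x, |(ν₁.shift d₁ x : ℝ) - ν.shift d x| < ε) → ν₁.shift d₁ ∈ r'.toSet := by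
  have hb : ∀ x, ∃ ε : ℝ, 0 < ε ∧ (r'.intPart x : ℝ) + ε ≤ ν.shift d x ∧
      (ν.shift d x : ℝ) + ε ≤ r'.intPart x + 1 := by
    intro x
    have e := Int.floor_add_fract (ν.shift d x : ℝ)
    have h1 : Int.fract (ν.shift d x : ℝ) ≠ 0 := fun h => h0 x ((hd.2.1 x).2 h)
    have h2 := lt_of_le_of_ne (Int.fract_nonneg _) h1.symm
    have h3 := Int.fract_lt_one (ν.shift d x : ℝ)
    rw [hd.1] at e
    push_cast at e
    refine ⟨min (Int.fract (ν.shift d x : ℝ)) (1 - Int.fract (ν.shift d x : ℝ)),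
      lt_min h2 (by linarith), ?_, ?_⟩
    · linarith [min_le_left (Int.fract (ν.shift d x : ℝ)) (1 - Int.fract (ν.shift d x : ℝ))]
    · linarith [min_le_right (Int.fract (ν.shift d x : ℝ)) (1 - Int.fract (ν.shift d x : ℝ))]
  choose ε hε hl hu using hb
  obtain ⟨ε₀, hε₀, hmin⟩ : ∃ ε₀ : ℝ, 0 < ε₀ ∧ ∀ x, ε₀ ≤ ε x := by
    rcases isEmpty_or_nonempty C with hC | hC
    · exact ⟨1, one_pos, fun x => (hC.false x).elim⟩
    · obtain ⟨x, hx⟩ := Finite.exists_min ε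
      exact ⟨ε x, hε x, hx⟩
  refine ⟨ε₀, hε₀, fun ν₁ hν₁ d₁ hclose => Region.mem_of_simOn hd (simOn_univ_of ?_ ?_ ?_)⟩
  -- Delays preserve differences, so this case needs no closeness.
  · intro x y k
    have := Region.simOn hν hν₁ Set.univ (some x) trivial (some y) trivial k
    simp only [Valuation.ext_some] at this
    simp only [Valuation.shift_coe]
    constructor <;> intro h'
    · linarith [this.1 (by linarith)]
    · linarith [this.2 (by linarith)]
  all_goals
    intro x k
    have h1 := abs_lt.1 (hclose x)
    have h2 := hmin x
    have h3 := hl x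
    have h4 := hu x
    have h5 := hε x
    rcases le_or_gt k (r'.intPart x : ℤ) with hk | hk
  · have hk' : (k : ℝ) ≤ r'.intPart x := by exact_mod_cast hk
    exact iff_of_false (by linarith) (by linarith)
  · have hk' : (r'.intPart x : ℝ) + 1 ≤ k := by exact_mod_cast hk
    exact iff_of_true (by linarith) (by linarith)
  · have hk' : (k : ℝ) ≤ r'.intPart x := by exact_mod_cast hk
    exact iff_of_true (by linarith) (by linarith)
  · have hk' : (r'.intPart x : ℝ) + 1 ≤ k := by exact_mod_cast hk
    exact iff_of_false (by linarith) (by linarith)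

/-- If the target region has an integral clock `z`, delays are determined by that clock. -/
theorem Region.exists_shift_of_block_eq_zero {r r' : Region C M} {z : C} (hz : r'.block z = 0)
    {ν ν₁ : Valuation C} (hν : ν ∈ r.toSet) {d : ℝ≥0} (hd : ν.shift d ∈ r'.toSet)
    (hν₁ : ν₁ ∈ r.toSet) :
    ∃ d₁ : ℝ≥0, (d₁ : ℝ) = ν z + d - ν₁ z ∧ ν₁.shift d₁ ∈ r'.toSet := by
  have e := Int.floor_add_fract (ν.shift d z : ℝ)
  rw [(hd.2.1 z).1 hz, hd.1, add_zero, Valuation.shift_coe] at e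
  have hsim := Region.simOn hν hν₁ Set.univ
  have hle : (ν₁ z : ℝ) ≤ r'.intPart z := by
    have := (hsim (some z) trivial none trivial (r'.intPart z)).1 (by
      simp only [Valuation.ext_some, Valuation.ext_none]
      linarith [d.coe_nonneg])
    simpa using this
  push_cast at e
  obtain ⟨d₁, hd₁⟩ : ∃ d₁ : ℝ≥0, (d₁ : ℝ) = ν z + d - ν₁ z :=
    NNReal.canLift.prf _ (by linarith)
  refine ⟨d₁, hd₁, Region.mem_of_simOn hd (simOn_univ_of ?_ ?_ ?_)⟩
  · intro x y k
    have := hsim (some x) trivial (some y) trivial k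
    simp only [Valuation.ext_some] at this
    simp only [Valuation.shift_coe]
    constructor <;> intro h'
    · linarith [this.1 (by linarith)]
    · linarith [this.2 (by linarith)]
  · intro x k
    -- After the delay `z` equals the integer `r'.intPart z`, so comparing `x` with `k` is comparing
    -- `x` with a translate of `z`.
    have := hsim (some x) trivial (some z) trivial (k - r'.intPart z)
    simp only [Valuation.ext_some] at this
    push_cast at this
    simp only [Valuation.shift_coe]
    constructor <;> intro h'
    · linarith [this.1 (by linarith)]
    · linarith [this.2 (by linarith)]
  · intro x k
    have := hsim (some z) trivial (some x) trivial (r'.intPart z - k)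
    simp only [Valuation.ext_some] at this
    push_cast at this
    simp only [Valuation.shift_coe]
    constructor <;> intro h'
    · linarith [this.1 (by linarith)]
    · linarith [this.2 (by linarith)]

theorem abs_reset_sub_lt {ν μ : Valuation C} {R : Set C} {ε : ℝ} (hε : 0 < ε)
    (h : ∀ x, |(ν x : ℝ) - μ x| < ε) (x : C) : |(ν.reset R x : ℝ) - μ.reset R x| < ε := by
  by_cases hx : x ∈ R
  · simpa [Valuation.reset, hx] using hε
  · simpa [Valuation.reset, hx] using h x

/-! ### Robust paths: backward induction -/

/-- Uniformly in small `δ`, the set `s δ` contains a relative neighbourhood of a point of `r`. -/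
def HasCore (r : Region C M) (s : ℝ≥0 → Set (Valuation C)) : Prop :=
  ∃ η : ℝ≥0, 0 < η ∧ ∃ ν ∈ r.toSet, ∀ δ ≤ η, ∀ ν₁ ∈ r.toSet,
    (∀ x, |(ν₁ x : ℝ) - ν x| < η) → ν₁ ∈ s δ

theorem HasCore.atomicCPre [Finite C] {r r' r'' : Region C M} {g : Guard C} {R : Set C}
    {s : ℝ≥0 → Set (Valuation C)} (hs : HasCore r'' s) (hsucc : r.TimeSucc r')
    (hreset : r'.IsReset R r'') (hg : g.NonPunctual → r'.NonPunctual) :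
    HasCore r fun δ => atomicCPre δ r r' g R (s δ) := by
  obtain ⟨η, hη, ν'', hν'', hcore⟩ := hs
  obtain ⟨ν', hν', rfl⟩ := hreset.exists_pred hν''
  obtain ⟨ν, hν, d, rfl⟩ := hsucc.exists_pred hν'
  have hηr : (0 : ℝ) < η := hη
  by_cases hb : ∀ x, r'.block x ≠ 0
  · obtain ⟨ε, hε, hmargin⟩ := Region.exists_margin hb hν hν'
    -- One `θ` pays for the distance from `ν₁` to `ν`, two for the window of width `2 * δ`.
    obtain ⟨θ, hθ, hθη, hθε⟩ : ∃ θ : ℝ≥0, 0 < θ ∧ (3 * θ : ℝ) ≤ η ∧ (3 * θ : ℝ) ≤ ε := by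
      have hmin : 0 < min (η : ℝ) ε := lt_min hηr hε
      obtain ⟨θ, hθ⟩ : ∃ θ : ℝ≥0, (θ : ℝ) = min (η : ℝ) ε / 3 := NNReal.canLift.prf _ (by positivity)
      refine ⟨θ, NNReal.coe_pos.1 (by rw [hθ]; positivity), ?_, ?_⟩
      · linarith [min_le_left (η : ℝ) ε]
      · linarith [min_le_right (η : ℝ) ε]
    have hθr : (0 : ℝ) < θ := hθ
    refine ⟨θ, hθ, ν, hν, fun δ hδ ν₁ hν₁ hclose => ?_⟩
    have hδr : (δ : ℝ) ≤ θ := hδ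
    have key : ∀ d' : ℝ≥0, d ≤ d' → d' ≤ d + δ + δ →
        ν₁.shift d' ∈ r'.toSet ∧ (ν₁.shift d').reset R ∈ s δ := by
      intro d' h1 h2
      have h1r : (d : ℝ) ≤ d' := h1
      have h2r : (d' : ℝ) ≤ d + δ + δ := by exact_mod_cast h2
      have hc : ∀ x, |(ν₁.shift d' x : ℝ) - ν.shift d x| < 3 * θ := fun x => by
        have := abs_lt.1 (hclose x)
        rw [Valuation.shift_coe, Valuation.shift_coe, abs_lt]
        constructor <;> linarith
      have hmem := hmargin ν₁ hν₁ d' fun x => (hc x).trans_le hθε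
      have hδη : δ ≤ η := by
        rw [← NNReal.coe_le_coe]
        linarith
      exact ⟨hmem, hcore δ hδη _ (hreset _ hmem)
        (abs_reset_sub_lt hηr fun x => (hc x).trans_le hθη)⟩
    unfold TA.atomicCPre
    split_ifs
    -- Centring at `d + δ` makes the window start at `d` and ensures that the centre is at least
    -- `δ`.
    · refine ⟨hν₁, d + δ, le_add_self, fun d' hd' => key d' ?_ hd'.2⟩
      simpa using hd'.1
    · exact ⟨hν₁, d, key d le_rfl (by rw [add_assoc]; exact le_self_add)⟩
  · push Not at hb
    obtain ⟨z, hz⟩ := hb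
    have hgn : ¬ g.NonPunctual := fun h => (hg h).block_ne_zero z hz
    have hη2 : η / 2 ≤ η := half_le_self η.2
    -- The new delay carries the error at `z`, which adds to the error at `x`.
    refine ⟨η / 2, half_pos hη, ν, hν, fun δ hδ ν₁ hν₁ hclose => ?_⟩
    obtain ⟨d₁, hd₁, hmem⟩ := Region.exists_shift_of_block_eq_zero hz hν hν' hν₁
    have hc : ∀ x, |(ν₁.shift d₁ x : ℝ) - ν.shift d x| < η := fun x => by
      have h1 := hclose x
      have h2 := hclose z
      push_cast at h1 h2
      rw [abs_lt] at h1 h2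
      rw [Valuation.shift_coe, Valuation.shift_coe, hd₁, abs_lt]
      constructor <;> linarith
    simp only [TA.atomicCPre, hgn, if_false]
    exact ⟨hν₁, d₁, hmem, hcore δ (hδ.trans hη2) _ (hreset _ hmem) (abs_reset_sub_lt hηr hc)⟩

theorem hasCore_cPre {L C : Type*} [Finite C] (A : TimedAutomaton L C)
    (q : RegionState L C A.bound) : ∀ (π : List (Transition L C A.bound))
    (p : RegionState L C A.bound), IsRegionPath A p π q → (π = [] ∨ WellFormed π) → Robust π →
      HasCore p.2 fun δ => CPre δ π q.2.toSet
  | [], p, hpath, _, _ => by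
    obtain ⟨ν, hν⟩ := p.2.toSet_nonempty
    have hpq : p = q := hpath
    exact ⟨1, one_pos, ν, hν, fun δ _ ν₁ hν₁ _ => hpq ▸ hν₁⟩
  | .delay l r₁ r₂ :: .edge e r₃ r₄ :: π, p, hpath, hwf, hrob => by
    obtain ⟨hp, hsucc, hsrc, ⟨_, _, hreset⟩, hrest⟩ := hpath
    obtain rfl : r₃ = r₂ := (Prod.ext_iff.1 hsrc).2
    subst hp
    have hwf' : π = [] ∨ WellFormed π := by simpa [WellFormed] using hwf
    have ih := hasCore_cPre A q π _ hrest hwf' fun e r r' h =>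
      hrob e r r' (List.mem_cons_of_mem _ (List.mem_cons_of_mem _ h))
    exact HasCore.atomicCPre (g := e.guard) ih hsucc hreset
      (hrob e r₃ r₄ (List.mem_cons_of_mem _ List.mem_cons_self))
  | [.delay _ _ _], _, _, hwf, _ => by simp [WellFormed] at hwf
  | .delay _ _ _ :: .delay _ _ _ :: _, _, _, hwf, _ => by simp [WellFormed] at hwf
  | .edge _ _ _ :: _, _, _, hwf, _ => by simp [WellFormed] at hwf

/-! ### Non-empty predecessors force robustness -/

theorem atomicCPre_nonempty {δ : ℝ≥0} (hδ : 0 < δ) {r r' : Region C M} {g : Guard C} {R : Set C}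
    {s : Set (Valuation C)} (h : (atomicCPre δ r r' g R s).Nonempty) :
    s.Nonempty ∧ (g.NonPunctual → r'.NonPunctual) := by
  obtain ⟨ν, hν⟩ := h
  unfold atomicCPre at hν
  split_ifs at hν with hg
  · obtain ⟨_, d, _, hd⟩ := hν
    have h1 := hd d ⟨tsub_le_self, le_self_add⟩
    have h2 := hd (d + δ) ⟨tsub_le_self.trans le_self_add, le_rfl⟩
    refine ⟨⟨_, h1.2⟩, fun hg => ⟨ν.shift d, δ, ?_, h1.1, ?_⟩⟩
    -- Without clocks there is only one valuation, so no guard is non-punctual.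
    · have : Nonempty C := by
        by_contra hC
        rw [not_nonempty_iff] at hC
        obtain ⟨μ, d, hne, -⟩ := hg
        exact hne (Subsingleton.elim _ _)
      exact (shift_ne_iff _ _).2 hδ.ne'
    · have : (ν.shift d).shift δ = ν.shift (d + δ) := by
        funext x
        simp [Valuation.shift, add_assoc]
      rw [this]
      exact h2.1
  · obtain ⟨_, d, _, hd⟩ := hν
    exact ⟨⟨_, hd⟩, fun h => absurd h hg⟩

theorem robust_of_cPre_nonempty {L C : Type*} (A : TimedAutomaton L C)
    (q : RegionState L C A.bound) {δ : ℝ≥0} (hδ : 0 < δ) {s : Set (Valuation C)} :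
    ∀ (π : List (Transition L C A.bound)) (p : RegionState L C A.bound), IsRegionPath A p π q →
      (CPre δ π s).Nonempty → Robust π
  | [], _, _, _ => fun _ _ _ h => by simp at h
  | .delay l r₁ r₂ :: .edge e r₃ r₄ :: π, _, hpath, hne => by
    obtain ⟨-, -, hsrc, -, hrest⟩ := hpath
    obtain rfl : r₃ = r₂ := (Prod.ext_iff.1 hsrc).2
    obtain ⟨h1, h2⟩ := atomicCPre_nonempty hδ hne
    have ih := robust_of_cPre_nonempty A q hδ π _ hrest h1
    intro e' r r' hmem
    simp only [List.mem_cons, reduceCtorEq, false_or, Transition.edge.injEq] at hmem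
    rcases hmem with ⟨rfl, rfl, rfl⟩ | hmem
    · exact h2
    · exact ih e' r r' hmem
  | [.delay _ _ _], _, _, hne => by simp [CPre] at hne
  | .delay _ _ _ :: .delay _ _ _ :: _, _, _, hne => by simp [CPre] at hne
  | .edge _ _ _ :: _, _, _, hne => by simp [CPre] at hne

end TA

theorem mainTheorem3 {L C : Type*} [Finite L] [Finite C] (A : TA.TimedAutomaton L C)
    (l l' : L) (r r' : TA.Region C A.bound) (π : List (TA.Transition L C A.bound))
    (hpath : TA.IsRegionPath A (l, r) π (l', r')) (hwf : TA.WellFormed π) :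
    (∃ δ : NNReal, 0 < δ ∧ (TA.CPre δ π r'.toSet).Nonempty) ↔ TA.Robust π := by
  constructor
  · rintro ⟨δ, hδ, hne⟩
    exact TA.robust_of_cPre_nonempty A _ hδ π _ hpath hne
  · intro hrob
    obtain ⟨η, hη, ν, hν, hcore⟩ := TA.hasCore_cPre A _ π _ hpath (Or.inr hwf) hrob
    exact ⟨η, hη, ν, hcore η le_rfl ν hν fun x => by simpa using hη⟩
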